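/- Convergence of Reach-Avoid Q-Learning. Let $\mathbf S$ and $\mathbf U$ be finite nonempty sets of states and actions (for instance finite discretizations of subsets of $\mathbb R^n$ and $\mathbb R^m$), $\mathbf f:\mathbf S\times\mathbf U\to\mathbf S$ a deterministic transition map, $l,g:\mathbf S\to\mathbb R$ the target and safety margin functions, and $\gamma\in[0,1)$. Let $\operatorname{opt}$ denote either $\min$ or $\max$ over $\mathbf U$, the same choice throughout. For $Q:\mathbf S\times\mathbf U\to\mathbb R$ put $$TQ(s,u)=(1-\gamma)\max\{l(s),g(s)\}+\gamma\max\Big\{g(s),\min\big\{l(s),\operatorname*{opt}_{u'\in\mathbf U}Q(\mathbf f(s,u),u')\big\}\Big\},$$ and for $V:\mathbf S\to\mathbb R$ put $$BV(s)=\gamma\max\Big\{\min\big\{\operatorname*{opt}_{u\in\mathbf U}V(\mathbf f(s,u)),\,l(s)\big\},\,g(s)\Big\}+(1-\gamma)\max\{l(s),g(s)\}.$$ On a probability space let $(s_k,u_k)_{k\ge 0}$ be a random sequence in $\mathbf S\times\mathbf U$ produced in episodes: $s_{k+1}=\mathbf f(s_k,u_k)$ almost surely unless a new episode starts at step $k+1$,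 and almost surely infinitely many episodes start. Let $(\mathcal G_k)_{k\ge0}$ be a filtration such that $\mathcal G_k$ contains the event that an episode starts at step $k$, and $s_k,u_k$ are $\mathcal G_{k+1}$-measurable. Assume that for some $\varepsilon>0$ and all $k$, almost surely: if an episode starts at step $k$, then $\mathbb P(s_k=s\mid\mathcal G_k)\ge\varepsilon$ for every $s\in\mathbf S$ (partly random initialization with full support); and $\mathbb P(u_k=u\mid\mathcal G_k,s_k)\ge\varepsilon$ for every $u\in\mathbf U$ (learning policy with full support). From an arbitrary, possibly random, initial table $Q_0$, let $$Q_{k+1}(s,u)=Q_k(s,u)+\alpha_k(s,u)\big[TQ_k(s,u)-Q_k(s,u)\big]\quad\text{if }(s,u)=(s_k,u_k),$$ and $Q_{k+1}(s,u)=Q_k(s,u)$ otherwise, where the learning rates $\alpha_k(s,u)\ge0$ (possibly random) satisfy almost surely, for all $s\in\mathbf S$, $u\in\mathbf U$: the sum of $\alpha_k(s,u)^2$ over the steps $k$ with $(s_k,u_k)=(s,u)$ is finite, and, if there are infinitely many such steps, the sum of $\alpha_k(s,u)$ over them is infinite. Then $T$ has exactly one fixed point $Q:\mathbf S\times\mathbf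 U\to\mathbb R$; the function $V_\gamma(s)=\operatorname{opt}_{u\in\mathbf U}Q(s,u)$ is the unique solution of $V=BV$, which for $\operatorname{opt}=\min$ is the discounted reach-avoid Bellman equation; and, with probability $1$, $\lim_{k\to\infty}Q_k(s,u)=Q(s,u)$ for all $s\in\mathbf S$, $u\in\mathbf U$. -/

import Mathlib

open MeasureTheory ProbabilityTheory Filter Topology

namespace ReachAvoid

/-- Minimum of a real function over the (finite, nonempty) action set. -/
def minOver {U : Type*} [Fintype U] [Nonempty U] (h : U → ℝ) : ℝ :=
  Finset.univ.inf' Finset.univ_nonempty h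

/-- Maximum of a real function over the (finite, nonempty) action set. -/
def maxOver {U : Type*} [Fintype U] [Nonempty U] (h : U → ℝ) : ℝ :=
  Finset.univ.sup' Finset.univ_nonempty h

/-- The discounted reach-avoid Bellman operator on state value functions,
`B V (s) = γ max {min {opt_u V (f (s, u)), l s}, g s} + (1 - γ) max {l s, g s}`.
Here `opt` is the operation over the actions; the control problem minimizes its payoff,
so that `opt = minOver` there. -/
def bellman {S U : Type*} (opt : (U → ℝ) → ℝ) (f : S → U → S) (l g : S → ℝ) (γ : ℝ)
    (V : S → ℝ) (s : S) : ℝ :=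
  γ * max (min (opt fun u => V (f s u)) (l s)) (g s) + (1 - γ) * max (l s) (g s)

/-- The discounted reach-avoid Bellman operator on state-action value functions (the target
of the temporal difference rule),
`T Q (s, u) = (1 - γ) max {l s, g s} + γ max {g s, min {l s, opt_{u'} Q (f (s, u), u')}}`. -/
def qBellman {S U : Type*} (opt : (U → ℝ) → ℝ) (f : S → U → S) (l g : S → ℝ) (γ : ℝ)
    (Q : S → U → ℝ) (s : S) (u : U) : ℝ :=
  (1 - γ) * max (l s) (g s) + γ * max (g s) (min (l s) (opt fun u' => Q (f s u) u'))

open Classical in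
/-- The table of tabular reach-avoid Q-learning after `k` steps, along a given sequence of
visited states `st` and actions `ac`, with learning rates `α` and initial table `Q₀`: at step
`k` the entry of the pair `(st k, ac k)` moves by the temporal difference rule and no other
entry changes. -/
noncomputable def qTable {S U : Type*} (opt : (U → ℝ) → ℝ) (f : S → U → S) (l g : S → ℝ) (γ : ℝ)
    (st : ℕ → S) (ac : ℕ → U) (α : ℕ → S → U → ℝ) (Q₀ : S → U → ℝ) : ℕ → S → U → ℝ
  | 0 => Q₀
  | k + 1 => fun s u =>
      let Q := qTable opt f l g γ st ac α Q₀ k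
      if st k = s ∧ ac k = u then
        Q s u + α k s u * (qBellman opt f l g γ Q s u - Q s u)
      else Q s u

open Classical in
/-- The learning rate with which the entry `(s, u)` is updated at step `k`; it is zero at the
steps that do not update this entry. -/
noncomputable def effRate {S U : Type*} (st : ℕ → S) (ac : ℕ → U) (α : ℕ → S → U → ℝ)
    (s : S) (u : U) (k : ℕ) : ℝ :=
  if st k = s ∧ ac k = u then α k s u else 0

/-- Episodic exploration of the deterministic system `f`. `start k` is the event that an
episode starts at step `k`; `𝒢 k` is the information available just before the state of step
`k` is produced (it contains all earlier states and actions, the decision whether to start an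
episode at step `k`, and anything else that the learner may use). -/
structure Exploration {S U Ω : Type*} [m : MeasurableSpace Ω] (μ : Measure Ω)
    (f : S → U → S) (ε : ℝ) (𝒢 : Filtration ℕ m) (start : ℕ → Set Ω)
    (state : ℕ → Ω → S) (action : ℕ → Ω → U) : Prop where
  start_meas : ∀ k, MeasurableSet[𝒢 k] (start k)
  state_meas : ∀ k s, MeasurableSet[𝒢 (k + 1)] {ω | state k ω = s}
  action_meas : ∀ k u, MeasurableSet[𝒢 (k + 1)] {ω | action k ω = u}
  /-- Inside an episode the state follows the transition map. -/
  transition : ∀ k, ∀ᵐ ω ∂μ, ω ∉ start (k + 1) →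
    state (k + 1) ω = f (state k ω) (action k ω)
  /-- Exploration goes on forever: infinitely many episodes are run. -/
  episodes : ∀ᵐ ω ∂μ, ∃ᶠ k in atTop, ω ∈ start k
  /-- Partly random episode initialization, with full support over the states. -/
  init_support : ∀ k s, ∀ᵐ ω ∂μ, ω ∈ start k → ε ≤ (μ⟦{ω' | state k ω' = s} | 𝒢 k⟧) ω
  /-- Randomized learning policy with full support over the actions: the conditioning is on
  the past and the current state. -/
  policy_support : ∀ k u, ∀ᵐ ω ∂μ,
    ε ≤ (μ⟦{ω' | action k ω' = u} | 𝒢 k ⊔ MeasurableSpace.comap (state k) ⊤⟧) ω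

end ReachAvoid

namespace ReachAvoid

/-! Since `f` is deterministic, the temporal difference target is exactly `T Q_k`, without sampling
noise, so convergence can be shown path by path. Minima and maxima are nonexpansive, hence `T` is a
`γ`-contraction in the sup norm. If all errors are at most `F`, an update with rate `a ≤ 1` gives an
entry an error at most `(1 - a) e + a γ F`; with divergent rate sums every entry eventually drops
below `(1 + γ) / 2 * F`, and iterating gives convergence
(`tendsto_zero_of_asynchronous_contraction`).

Probability enters only in `Exploration.frequently_visits`: each pair has conditional probability at
least `ε ^ 2` at every episode start, so Lévy's conditional Borel-Cantelli lemma yields infinitely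
many visits. -/

/-- A sequence contracted by the factors `1 - a k`, where `∑ a k` diverges, is eventually below
every positive number. -/
theorem eventually_lt_of_contracted {y a : ℕ → ℝ}
    (hstep : ∀ᶠ k in atTop, a k ≤ 1 ∧ y (k + 1) ≤ (1 - a k) * y k)
    (hsum : Tendsto (fun N => ∑ k ∈ Finset.range N, a k) atTop atTop)
    {δ : ℝ} (hδ : 0 < δ) : ∀ᶠ k in atTop, y k < δ := by
  obtain ⟨K, hK⟩ := eventually_atTop.1 hstep
  set A : ℕ → ℝ := fun N => ∑ k ∈ Finset.range N, a k with hA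
  -- Since `y K` may be negative, `max (y K) 0` keeps the bound nonnegative, as replacing `1 - a k`
  -- by `exp (-a k)` requires.
  have hbound : ∀ k, K ≤ k → y k ≤ max (y K) 0 * Real.exp (A K - A k) := by
    intro k hk
    induction k, hk using Nat.le_induction with
    | base => simp
    | succ k hk ih =>
      obtain ⟨h1, h2⟩ := hK k hk
      have hexp : 1 - a k ≤ Real.exp (-a k) := by
        have := Real.add_one_le_exp (-a k)
        linarith
      have hsucc : A K - A (k + 1) = -a k + (A K - A k) := by
        simp only [hA, Finset.sum_range_succ]
        ring
      calc y (k + 1) ≤ (1 - a k) * y k := h2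
        _ ≤ (1 - a k) * (max (y K) 0 * Real.exp (A K - A k)) :=
          mul_le_mul_of_nonneg_left ih (by linarith)
        _ ≤ Real.exp (-a k) * (max (y K) 0 * Real.exp (A K - A k)) :=
          mul_le_mul_of_nonneg_right hexp (by positivity)
        _ = max (y K) 0 * Real.exp (A K - A (k + 1)) := by
          rw [hsucc, Real.exp_add]
          ring
  have hlim : Tendsto (fun k => max (y K) 0 * Real.exp (A K - A k)) atTop (𝓝 0) := by
    have h := (Real.tendsto_exp_atBot.comp
      (tendsto_atBot_add_const_left atTop (A K) (tendsto_neg_atTop_atBot.comp hsum))).const_mul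
        (max (y K) 0)
    simpa [Function.comp_def, sub_eq_add_neg] using h
  filter_upwards [hlim.eventually_lt_const hδ, eventually_ge_atTop K] with k h1 h2
  exact (hbound k h2).trans_lt h1

/-- Asynchronous relaxation of a `γ`-contraction drives the componentwise errors to zero. -/
theorem tendsto_zero_of_asynchronous_contraction {ι : Type*} [Finite ι] {e a : ℕ → ι → ℝ} {γ : ℝ}
    (hγ₀ : 0 ≤ γ) (hγ₁ : γ < 1) (he : ∀ k i, 0 ≤ e k i) (ha₀ : ∀ k i, 0 ≤ a k i)
    (ha : ∀ i, Tendsto (fun k => a k i) atTop (𝓝 0))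
    (hsum : ∀ i, Tendsto (fun N => ∑ k ∈ Finset.range N, a k i) atTop atTop)
    (hstep : ∀ k D, (∀ j, e k j ≤ D) → ∀ i, a k i ≤ 1 →
      e (k + 1) i ≤ (1 - a k i) * e k i + a k i * (γ * D)) (i : ι) :
    Tendsto (fun k => e k i) atTop (𝓝 0) := by
  have ha₁ : ∀ᶠ k in atTop, ∀ i, a k i ≤ 1 :=
    eventually_all.2 fun i => (ha i).eventually_le_const one_pos
  obtain ⟨K, hK⟩ := eventually_atTop.1 ha₁
  obtain ⟨D, hD⟩ := (Set.finite_range (e K)).bddAbove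
  have hD₁ : ∀ j, e K j ≤ max D 1 := fun j => (hD ⟨j, rfl⟩).trans (le_max_left _ _)
  have hD₀ : 0 < max D 1 := one_pos.trans_le (le_max_right _ _)
  set E := max D 1
  have hinit : ∀ᶠ k in atTop, ∀ j, e k j ≤ E := by
    filter_upwards [eventually_ge_atTop K] with k hk
    induction k, hk using Nat.le_induction with
    | base => exact hD₁
    | succ k hk ih =>
      intro j
      have h1 := mul_le_mul_of_nonneg_left (ih j) (sub_nonneg.2 (hK k hk j))
      have h2 := mul_le_mul_of_nonneg_left
        (mul_le_of_le_one_left hD₀.le hγ₁.le) (ha₀ k j)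
      linarith [hstep k E ih j (hK k hk j)]
  -- The level `γ * F` may be approached only in the limit; the midpoint factor `(1 + γ) / 2` leaves
  -- slack `(1 - γ) / 2 * F`, positive because `E ≥ 1`.
  have himprove : ∀ n : ℕ, ∀ᶠ k in atTop, ∀ j, e k j ≤ ((1 + γ) / 2) ^ n * E := by
    intro n
    induction n with
    | zero => simpa using hinit
    | succ n ih =>
      set F := ((1 + γ) / 2) ^ n * E
      have hF : 0 < F := by positivity
      refine eventually_all.2 fun j => ?_
      -- Subtracting `γ * F` makes the recursion homogeneous.
      have hlt := eventually_lt_of_contracted (y := fun k => e k j - γ * F)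
        (a := fun k => a k j) (δ := (1 - γ) / 2 * F) (by
          filter_upwards [ha₁, ih] with k h1 h2
          exact ⟨h1 j, by linarith [hstep k F h2 j (h1 j)]⟩) (hsum j)
        (mul_pos (by linarith) hF)
      filter_upwards [hlt] with k hk
      have : ((1 + γ) / 2) ^ (n + 1) * E = (1 + γ) / 2 * F := by
        rw [pow_succ']
        ring
      rw [this]
      linarith
  have hpow : Tendsto (fun n : ℕ => ((1 + γ) / 2) ^ n * E) atTop (𝓝 0) := by
    simpa using (tendsto_pow_atTop_nhds_zero_of_lt_one (by linarith : 0 ≤ (1 + γ) / 2)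
      (by linarith)).mul_const E
  rw [tendsto_order]
  refine ⟨fun b hb => Eventually.of_forall fun k => hb.trans_le (he k i), fun b hb => ?_⟩
  obtain ⟨n, hn⟩ := (hpow.eventually_lt_const hb).exists
  filter_upwards [himprove n] with k hk
  exact (hk i).trans_lt hn

/-! ### Bellman operators and pathwise convergence. -/

section Bellman

variable {S U : Type*} [Fintype U] [Nonempty U] {opt : (U → ℝ) → ℝ}

/-- Minima and maxima over the actions commute with monotone maps. -/
theorem opt_comp (hopt : opt = minOver ∨ opt = maxOver) {φ : ℝ → ℝ} (hφ : Monotone φ)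
    (h : U → ℝ) : opt (fun u => φ (h u)) = φ (opt h) := by
  rcases hopt with rfl | rfl
  · exact (Finset.apply_inf'_eq_inf'_comp Finset.univ_nonempty φ fun x y => hφ.map_min).symm
  · exact (Finset.apply_sup'_eq_sup'_comp Finset.univ_nonempty φ fun x y => hφ.map_max).symm

theorem opt_mono (hopt : opt = minOver ∨ opt = maxOver) : Monotone opt := by
  intro h h' hle
  rcases hopt with rfl | rfl
  · exact Finset.inf'_mono_fun fun u _ => hle u
  · exact Finset.sup'_mono_fun fun u _ => hle u

/-- A monotone map that commutes with adding constants is nonexpansive in the sup norm. -/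
theorem abs_opt_sub_opt_le (hopt : opt = minOver ∨ opt = maxOver) {h h' : U → ℝ} {C : ℝ}
    (hC : ∀ u, |h u - h' u| ≤ C) : |opt h - opt h'| ≤ C := by
  have key : ∀ p q : U → ℝ, (∀ u, p u ≤ q u + C) → opt p ≤ opt q + C := fun p q hpq => by
    rw [← opt_comp hopt (φ := fun x => x + C) (fun x y hxy => by simpa using hxy) q]
    exact opt_mono hopt hpq
  rw [abs_sub_le_iff, sub_le_iff_le_add', sub_le_iff_le_add']
  exact ⟨key _ _ fun u => by linarith [(abs_le.1 (hC u)).2],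
    key _ _ fun u => by linarith [(abs_le.1 (hC u)).1]⟩

variable (f : S → U → S) (l g : S → ℝ) {γ : ℝ}

theorem abs_qBellman_sub_le (hopt : opt = minOver ∨ opt = maxOver) (hγ₀ : 0 ≤ γ)
    {Q Q' : S → U → ℝ} {D : ℝ} (hD : ∀ s u, |Q s u - Q' s u| ≤ D) (s : S) (u : U) :
    |qBellman opt f l g γ Q s u - qBellman opt f l g γ Q' s u| ≤ γ * D := by
  simp only [qBellman, add_sub_add_left_eq_sub, ← mul_sub, abs_mul, abs_of_nonneg hγ₀]
  refine mul_le_mul_of_nonneg_left ?_ hγ₀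
  rw [max_comm (g s), max_comm (g s), min_comm (l s), min_comm (l s)]
  refine (abs_max_sub_max_le_abs _ _ _).trans ((abs_min_sub_min_le_max _ _ _ _).trans ?_)
  rw [sub_self, abs_zero]
  exact max_le (abs_opt_sub_opt_le hopt (hD (f s u))) ((abs_nonneg _).trans (hD s u))

theorem exists_unique_fixed_qBellman [Finite S] (hopt : opt = minOver ∨ opt = maxOver)
    (hγ₀ : 0 ≤ γ) (hγ₁ : γ < 1) :
    ∃ Q : S → U → ℝ, ∀ Q', qBellman opt f l g γ Q' = Q' ↔ Q' = Q := by
  cases nonempty_fintype S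
  have hc : ContractingWith ⟨γ, hγ₀⟩ (qBellman opt f l g γ) := by
    refine ⟨hγ₁, LipschitzWith.of_dist_le_mul fun Q Q' => ?_⟩
    have h0 : 0 ≤ γ * dist Q Q' := by positivity
    refine (dist_pi_le_iff h0).2 fun s => (dist_pi_le_iff h0).2 fun u => ?_
    refine abs_qBellman_sub_le f l g hopt hγ₀ (fun s u => ?_) s u
    exact (dist_le_pi_dist (Q s) (Q' s) u).trans (dist_le_pi_dist Q Q' s)
  exact ⟨_, fun Q' => ⟨fun h => hc.fixedPoint_unique h, fun h => h ▸ hc.fixedPoint_isFixedPt⟩⟩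

/-- Solutions of the state Bellman equation are the optimized solutions of the state-action
Bellman equation. -/
theorem bellman_eq_iff (hopt : opt = minOver ∨ opt = maxOver) (hγ₀ : 0 ≤ γ) {Q : S → U → ℝ}
    (hQ : ∀ Q', qBellman opt f l g γ Q' = Q' ↔ Q' = Q) (V : S → ℝ) :
    bellman opt f l g γ V = V ↔ V = fun s => opt (Q s) := by
  -- The two operators are the two composites of `opt` and `R`: `T = R ∘ opt` and `B = opt ∘ R`.
  -- Hence `opt` and `R` exchange their fixed points.
  let R : (S → ℝ) → S → U → ℝ := fun W s u =>
    (1 - γ) * max (l s) (g s) + γ * max (g s) (min (l s) (W (f s u)))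
  have hR : ∀ W s, opt (R W s) = bellman opt f l g γ W s := by
    intro W s
    have hφ : Monotone fun x => (1 - γ) * max (l s) (g s) + γ * max (g s) (min (l s) x) :=
      fun x y hxy => add_le_add_right (mul_le_mul_of_nonneg_left
        (max_le_max_left _ (min_le_min_left _ hxy)) hγ₀) _
    rw [show R W s = fun u => (1 - γ) * max (l s) (g s) +
      γ * max (g s) (min (l s) (W (f s u))) from rfl, opt_comp hopt hφ fun u => W (f s u)]
    simp only [bellman]
    rw [max_comm (g s), min_comm (l s), add_comm]
  have hT : ∀ Q', qBellman opt f l g γ Q' = R fun s => opt (Q' s) := fun _ => rfl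
  constructor
  · intro hV
    have hopt_R : (fun s => opt (R V s)) = V := by
      funext s
      rw [hR, hV]
    have hfix : R V = Q := (hQ _).1 (by rw [hT, hopt_R])
    rw [← hfix, hopt_R]
  · rintro rfl
    have hfix := (hQ Q).2 rfl
    funext s
    rw [← hR, ← hT, hfix]

/-- Along every sequence of updates with Robbins-Monro rates, the tables converge to the fixed
point. -/
theorem tendsto_qTable [Finite S] (hopt : opt = minOver ∨ opt = maxOver)
    (hγ₀ : 0 ≤ γ) (hγ₁ : γ < 1) {Q : S → U → ℝ} (hQ : qBellman opt f l g γ Q = Q)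
    (st : ℕ → S) (ac : ℕ → U) (α : ℕ → S → U → ℝ) (Q₀ : S → U → ℝ)
    (hα : ∀ k s u, 0 ≤ α k s u)
    (hsum : ∀ s u, Tendsto (fun N => ∑ k ∈ Finset.range N, effRate st ac α s u k) atTop atTop)
    (hsq : ∀ s u, Summable fun k => effRate st ac α s u k ^ 2) (s : S) (u : U) :
    Tendsto (fun k => qTable opt f l g γ st ac α Q₀ k s u) atTop (𝓝 (Q s u)) := by
  have hrate : ∀ k s u, 0 ≤ effRate st ac α s u k := by
    intro k s u
    unfold effRate
    split_ifs
    exacts [hα k s u, le_rfl]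
  rw [tendsto_iff_dist_tendsto_zero]
  refine tendsto_zero_of_asynchronous_contraction (ι := S × U)
    (e := fun k i => |qTable opt f l g γ st ac α Q₀ k i.1 i.2 - Q i.1 i.2|)
    (a := fun k i => effRate st ac α i.1 i.2 k) hγ₀ hγ₁ (fun _ _ => abs_nonneg _)
    (fun k i => hrate k i.1 i.2) (fun i => ?_) (fun i => hsum i.1 i.2) ?_ (s, u)
  -- Square summability is what makes the rates tend to zero, hence eventually at most `1`.
  · have h := (hsq i.1 i.2).tendsto_atTop_zero.sqrt
    simpa [Real.sqrt_sq (hrate _ i.1 i.2)] using h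
  · rintro k D hD ⟨s, u⟩ h1
    set P := qTable opt f l g γ st ac α Q₀ k with hP
    have hupdate : qTable opt f l g γ st ac α Q₀ (k + 1) s u =
        P s u + effRate st ac α s u k * (qBellman opt f l g γ P s u - P s u) := by
      simp only [qTable, effRate, ← hP]
      split_ifs <;> simp
    have hcontr := abs_qBellman_sub_le f l g hopt hγ₀ (fun s u => hD (s, u)) s u
    rw [hQ] at hcontr
    have hr := hrate k s u
    simp only at h1 ⊢
    rw [hupdate]
    set r := effRate st ac α s u k
    calc |P s u + r * (qBellman opt f l g γ P s u - P s u) - Q s u|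
        = |(1 - r) * (P s u - Q s u) + r * (qBellman opt f l g γ P s u - Q s u)| := by
          congr 1
          ring
      _ ≤ |(1 - r) * (P s u - Q s u)| + |r * (qBellman opt f l g γ P s u - Q s u)| :=
          abs_add_le _ _
      _ = (1 - r) * |P s u - Q s u| + r * |qBellman opt f l g γ P s u - Q s u| := by
          rw [abs_mul, abs_mul, abs_of_nonneg (sub_nonneg.2 h1), abs_of_nonneg hr]
      _ ≤ (1 - r) * |P s u - Q s u| + r * (γ * D) := by gcongr

end Bellman

/-! ### Exploration and infinitely many visits. -/

/-- Lower bounds for conditional probabilities multiply along a tower of σ-algebras. -/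
theorem mul_condProb_le_condProb_inter {Ω : Type*} {G H m : MeasurableSpace Ω} {μ : Measure Ω}
    [IsProbabilityMeasure μ] (hGH : G ≤ H) (hHm : H ≤ m) {A B : Set Ω} {ε : ℝ}
    (hA : MeasurableSet[H] A) (hB : MeasurableSet[m] B) (hε : ∀ᵐ ω ∂μ, ε ≤ (μ⟦B | H⟧) ω) :
    ∀ᵐ ω ∂μ, ε * (μ⟦A | G⟧) ω ≤ (μ[(A ∩ B).indicator (1 : Ω → ℝ) | G]) ω := by
  let iA : Ω → ℝ := A.indicator fun _ => 1
  let iB : Ω → ℝ := B.indicator fun _ => 1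
  have hiA : Integrable iA μ := (integrable_const 1).indicator (hHm _ hA)
  have hiB : Integrable iB μ := (integrable_const 1).indicator hB
  have hprod : (A ∩ B).indicator (1 : Ω → ℝ) = A.indicator iB := by
    rw [Set.indicator_indicator]
    rfl
  -- As `A` is `H`-measurable, its indicator factors out of the conditional expectation.
  have hle : ε • iA ≤ᵐ[μ] μ[A.indicator iB | H] := by
    filter_upwards [condExp_indicator hiB hA, hε] with ω h1 h2
    rw [h1]
    by_cases hω : ω ∈ A
    · simpa [iA, Set.indicator_of_mem hω] using h2
    · simp [iA, Set.indicator_of_notMem hω]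
  have htower : μ[μ[A.indicator iB | H] | G] =ᵐ[μ] μ[A.indicator iB | G] :=
    condExp_condExp_of_le hGH hHm
  rw [hprod]
  filter_upwards [htower, condExp_mono (m := G) (hiA.smul ε) integrable_condExp hle,
    condExp_smul (μ := μ) ε iA G] with ω h1 h2 h3
  rw [← h1]
  exact h3.symm.le.trans h2

section Exploration

variable {S U Ω : Type*} [Finite S] [m : MeasurableSpace Ω] {μ : Measure Ω}
  [IsProbabilityMeasure μ] {f : S → U → S} {ε : ℝ} {𝒢 : Filtration ℕ m} {start : ℕ → Set Ω}
  {state : ℕ → Ω → S} {action : ℕ → Ω → U}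

/-- At the start of an episode every state-action pair has conditional probability at least
`ε ^ 2`. -/
theorem Exploration.sq_le_condProb (h : Exploration μ f ε 𝒢 start state action) (hε : 0 < ε)
    (k : ℕ) (s : S) (u : U) : ∀ᵐ ω ∂μ, ω ∈ start k →
      ε ^ 2 ≤ (μ[({ω' | state k ω' = s ∧ action k ω' = u}).indicator (1 : Ω → ℝ) | 𝒢 k]) ω := by
  have hHm : 𝒢 k ⊔ MeasurableSpace.comap (state k) ⊤ ≤ m := by
    refine sup_le (𝒢.le k) ?_
    rintro _ ⟨t, -, rfl⟩
    rw [show state k ⁻¹' t = ⋃ x ∈ t, {ω' | state k ω' = x} by ext; simp]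
    exact MeasurableSet.biUnion t.to_countable fun x _ => 𝒢.le _ _ (h.state_meas k x)
  have hSH : MeasurableSet[𝒢 k ⊔ MeasurableSpace.comap (state k) ⊤] {ω' | state k ω' = s} :=
    (le_sup_right : MeasurableSpace.comap (state k) ⊤ ≤ _) _ ⟨{s}, trivial, rfl⟩
  filter_upwards [mul_condProb_le_condProb_inter le_sup_left hHm hSH
    (𝒢.le _ _ (h.action_meas k u)) (h.policy_support k u), h.init_support k s] with ω h1 h2 hω
  rw [sq]
  exact (mul_le_mul_of_nonneg_left (h2 hω) hε.le).trans h1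

/-- Episodic exploration almost surely visits every state-action pair infinitely often. -/
theorem Exploration.frequently_visits [Finite U]
    (h : Exploration μ f ε 𝒢 start state action) (hε : 0 < ε) :
    ∀ᵐ ω ∂μ, ∀ s u, ∃ᶠ k in atTop, state k ω = s ∧ action k ω = u := by
  refine ae_all_iff.2 fun s => ae_all_iff.2 fun u => ?_
  let E : ℕ → Set Ω := fun k => {ω | state k ω = s ∧ action k ω = u}
  -- The visit at step `k` is only `𝒢 (k + 1)`-measurable, so the adapted sequence is shifted by
  -- one, with `∅` at index `0`.
  let F : ℕ → Set Ω := fun n => n.casesOn ∅ E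
  have hF : ∀ n, MeasurableSet[𝒢 n] (F n) := by
    rintro (_ | k)
    · exact @MeasurableSet.empty _ (𝒢 0)
    · exact MeasurableSet.inter (h.state_meas k s) (h.action_meas k u)
  have hnonneg : ∀ᵐ ω ∂μ, ∀ k, 0 ≤ (μ[(E k).indicator (1 : Ω → ℝ) | 𝒢 k]) ω :=
    ae_all_iff.2 fun k => condExp_nonneg
      (Eventually.of_forall fun ω => Set.indicator_nonneg (fun _ _ => zero_le_one) ω)
  filter_upwards [ae_mem_limsup_atTop_iff μ hF, hnonneg, h.episodes,
    ae_all_iff.2 fun k => h.sq_le_condProb hε k s u] with ω hlim h0 hep hlow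
  have hdiv : Tendsto (fun n => ∑ k ∈ Finset.range n,
      (μ[(F (k + 1)).indicator (1 : Ω → ℝ) | 𝒢 k]) ω) atTop atTop := by
    -- Terms of a convergent series would fall below `ε ^ 2`, against the lower bound at infinitely
    -- many episode starts.
    refine (not_summable_iff_tendsto_nat_atTop_of_nonneg h0).1 fun hsummable => ?_
    obtain ⟨k, hk, hk'⟩ := (hep.and_eventually
      (hsummable.tendsto_atTop_zero.eventually_lt_const (pow_pos hε 2))).exists
    exact (hlow k hk).not_gt hk'
  have hfreq := mem_limsup_iff_frequently_mem.1 (hlim.2 hdiv)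
  rw [frequently_atTop] at hfreq ⊢
  intro N
  obtain ⟨n, hn, hmem⟩ := hfreq (N + 1)
  obtain ⟨k, rfl⟩ : ∃ k, n = k + 1 := ⟨n - 1, by omega⟩
  exact ⟨k, by omega, hmem⟩

end Exploration

end ReachAvoid

theorem proposition2 {S U Ω : Type*} [Finite S] [Fintype U] [Nonempty U]
    [m : MeasurableSpace Ω] (μ : Measure Ω) [IsProbabilityMeasure μ]
    (opt : (U → ℝ) → ℝ) (hopt : opt = ReachAvoid.minOver ∨ opt = ReachAvoid.maxOver)
    (f : S → U → S) (l g : S → ℝ) (γ : ℝ) (hγ₀ : 0 ≤ γ) (hγ₁ : γ < 1)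
    (ε : ℝ) (hε : 0 < ε) (𝒢 : Filtration ℕ m) (start : ℕ → Set Ω)
    (state : ℕ → Ω → S) (action : ℕ → Ω → U)
    (hexp : ReachAvoid.Exploration μ f ε 𝒢 start state action)
    (α : Ω → ℕ → S → U → ℝ)
    (hα_nonneg : ∀ᵐ ω ∂μ, ∀ k s u, 0 ≤ α ω k s u)
    (hα_sum : ∀ᵐ ω ∂μ, ∀ s u, (∃ᶠ k in atTop, state k ω = s ∧ action k ω = u) →
      Tendsto (fun N => ∑ k ∈ Finset.range N,
        ReachAvoid.effRate (fun j => state j ω) (fun j => action j ω) (α ω) s u k) atTop atTop)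
    (hα_sq : ∀ᵐ ω ∂μ, ∀ s u, Summable (fun k =>
      ReachAvoid.effRate (fun j => state j ω) (fun j => action j ω) (α ω) s u k ^ 2))
    (Q₀ : Ω → S → U → ℝ) :
    ∃ Q : S → U → ℝ,
      (∀ Q' : S → U → ℝ, ReachAvoid.qBellman opt f l g γ Q' = Q' ↔ Q' = Q) ∧
      (∀ V : S → ℝ, ReachAvoid.bellman opt f l g γ V = V ↔ V = fun s => opt (Q s)) ∧
      ∀ᵐ ω ∂μ, ∀ s u, Tendsto
        (fun k => ReachAvoid.qTable opt f l g γ (fun j => state j ω) (fun j => action j ω)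
          (α ω) (Q₀ ω) k s u) atTop (𝓝 (Q s u)) := by
  obtain ⟨Q, hQ⟩ := ReachAvoid.exists_unique_fixed_qBellman f l g hopt hγ₀ hγ₁
  refine ⟨Q, hQ, ReachAvoid.bellman_eq_iff f l g hopt hγ₀ hQ, ?_⟩
  filter_upwards [hα_nonneg, hα_sum, hα_sq, hexp.frequently_visits hε] with ω h0 hsum hsq hvisit
  exact ReachAvoid.tendsto_qTable f l g hopt hγ₀ hγ₁ ((hQ Q).2 rfl) _ _ _ _ h0
    (fun s u => hsum s u (hvisit s u)) hsq
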